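/- Let $J_1,J_2\subseteq\mathbb{R}$ be intervals and let $f:J_1\to J_2$ be $g$-convex on $J_1$, that is: $f$ is continuous on $J_1$, $g:J_2\to\mathbb{R}$ is strictly increasing and concave on $J_2$, and $g\circ f$ is convex on $J_1$. Write $g^{-1}:g(J_2)\to J_2$ for the inverse of $g$. Let $A_1,\dots,A_k$ be Hermitian $m\times m$ complex matrices whose spectra are contained in $J_1$, and let $w_1,\dots,w_k$ be positive real numbers with $\sum_{i=1}^k w_i=1$. For a Hermitian matrix $A$, let $\varphi(A)$ be defined by the functional calculus, and let $\lambda(A)\in\mathbb{R}^m$ be the vector of eigenvalues of $A$, counted with multiplicity and arranged in decreasing order. For $x,y\in\mathbb{R}^m$ with decreasing rearrangements $x^\downarrow,y^\downarrow$, write $x\prec_w y$ if $\sum_{j=1}^l x^\downarrow_j\le\sum_{j=1}^l y^\downarrow_j$ for all $1\le l\le m$. Then the spectrum of $\sum_i w_iA_i$ is contained in $J_1$ and the spectrum of $\sum_i w_i(g\circ f)(A_i)$ is contained in $g(J_2)$ (so that all matrices below are well defined), and \[\lambda\Big(f\Big(\sum_{i=1}^k w_iA_i\Big)\Big)\ \prec_w\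 \lambda\Big(g^{-1}\Big(\sum_{i=1}^k w_i(g\circ f)(A_i)\Big)\Big)\ \prec_w\ \lambda\Big(\sum_{i=1}^k w_if(A_i)\Big).\] -/

import Mathlib

open scoped Matrix

/-- `f : J₁ → J₂` is `g`-convex: `f` is continuous on the interval `J₁`, `g` is (strictly)
increasing and concave on the interval `J₂`, and `g ∘ f` is convex on `J₁`.
Functions are total on `ℝ`, but only their restrictions to `J₁`, `J₂` matter; that `J₁` and `J₂`
are intervals (convex subsets of `ℝ`) is part of `ConvexOn` and `ConcaveOn`. -/
structure IsGConvex (g f : ℝ → ℝ) (J₁ J₂ : Set ℝ) : Prop where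
  mapsTo : Set.MapsTo f J₁ J₂
  continuousOn : ContinuousOn f J₁
  strictMonoOn : StrictMonoOn g J₂
  concaveOn : ConcaveOn ℝ J₂ g
  convexOn_comp : ConvexOn ℝ J₁ (g ∘ f)

/-- The inverse `g⁻¹ : g(J₂) → J₂` of a function `g` that is injective on `J₂`
(with irrelevant values outside `g(J₂)`). -/
noncomputable def inverseOn (g : ℝ → ℝ) (J₂ : Set ℝ) : ℝ → ℝ :=
  Function.invFunOn g J₂

/-- The decreasing rearrangement of a real vector. -/
noncomputable def decreasingRearrangement {m : ℕ} (x : Fin m → ℝ) : Fin m → ℝ :=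
  fun i => x (Tuple.sort x i.rev)

/-- Weak majorization `x ≺_w y`: for every `l ≤ m`, the sum of the `l` largest entries of `x`
is at most the sum of the `l` largest entries of `y`. -/
def WeaklyMajorizedBy {m : ℕ} (x y : Fin m → ℝ) : Prop :=
  ∀ l : ℕ, l ≤ m →
    ∑ i : Fin m with i.val < l, decreasingRearrangement x i ≤
      ∑ i : Fin m with i.val < l, decreasingRearrangement y i

infix:50 " ≺ᵂ " => WeaklyMajorizedBy

/-- The vector of eigenvalues (with multiplicity) of a Hermitian matrix, in decreasing order. -/
noncomputable def eigenvalueVector {m : ℕ} {A : Matrix (Fin m) (Fin m) ℂ}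
    (hA : A.IsHermitian) : Fin m → ℝ :=
  fun i => hA.eigenvalues₀ (Fin.cast (Fintype.card_fin m).symm i)

theorem isHermitian_cfc {m : ℕ} (φ : ℝ → ℝ) (A : Matrix (Fin m) (Fin m) ℂ) :
    (cfc φ A).IsHermitian :=
  cfc_predicate φ A

theorem isHermitian_weightedSum {m k : ℕ} (w : Fin k → ℝ)
    {A : Fin k → Matrix (Fin m) (Fin m) ℂ} (hA : ∀ i, (A i).IsHermitian) :
    (∑ i, w i • A i).IsHermitian :=
  isSelfAdjoint_sum _ fun i _ => (IsSelfAdjoint.all (w i)).smul (hA i)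

/-!
Both majorizations come from one variational principle: if `(u_j)` is an orthonormal basis and
`a_j ≤ ⟪u_j, Z u_j⟫` for all `j`, then `a ≺ᵂ λ(Z)` (`weaklyMajorizedBy_eigenvalueVector`). Indeed a
sum of `l` diagonal entries of `Z` is a combination of the eigenvalues of `Z` with coefficients
in `[0, 1]` of total mass `l`.

The pointwise bounds come from Jensen's inequality in the form `φ ⟪u, B u⟫ ≤ ⟪u, φ(B) u⟫` for a
unit vector `u` and a convex `φ` (`map_quadraticForm_le`), which holds because `⟪u, φ(B) u⟫` is an
average of `φ` over the spectrum of `B` (`quadraticForm_cfc`). Put `h = g ∘ f`, `k = g⁻¹`,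
`X = ∑ w_i A_i` and `Y = ∑ w_i h(A_i)`. The function `k` is convex and increasing on `h(J₁)`, and
`f = k ∘ h`.

* For eigenvectors `u` of `X` with eigenvalue `t`, convexity of `h` gives `h t ≤ ⟪u, Y u⟫`, so that
  `f t = k (h t) ≤ k ⟪u, Y u⟫ ≤ ⟪u, k(Y) u⟫`.
* For eigenvectors `v` of `Y` with eigenvalue `t`, convexity of `k` gives
  `k t ≤ ∑ w_i ⟪v, k(h(A_i)) v⟫ = ⟪v, (∑ w_i f(A_i)) v⟫`.

For this `h(J₁)` has to be an interval (`IsGConvex.convex_image`). This needs an argument, as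
neither `g` nor `h` is assumed continuous: `g` may jump at the left endpoint of `J₂`, but convexity
of `g ∘ f` keeps `f` from seeing that jump.
-/

/-! ### Sums of largest entries -/

open Finset in
/-- A combination of the entries of an antitone vector with coefficients in `[0, 1]` of total mass
`l` is at most the sum of the first `l` entries. -/
theorem sum_mul_le_sum_filter_lt_of_antitone {m : ℕ} {y c : Fin m → ℝ} (hy : Antitone y)
    (hc0 : ∀ i, 0 ≤ c i) (hc1 : ∀ i, c i ≤ 1) {l : ℕ} (hl : l ≤ m) (hc : ∑ i, c i = l) :
    ∑ i, c i * y i ≤ ∑ i : Fin m with i.val < l, y i := by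
  rcases Nat.eq_zero_or_pos l with rfl | hpos
  · have : ∀ i, c i = 0 := fun i =>
      (sum_eq_zero_iff_of_nonneg fun i _ => hc0 i).1 (by simpa using hc) i (mem_univ i)
    simp [this]
  · -- Compare each entry with the `l`-th largest one, `t`.
    set t := y ⟨l - 1, by omega⟩ with ht
    have hcard : ∑ i : Fin m, (if i.val < l then (1 : ℝ) else 0) = l := by
      rw [← hc, sum_boole, Fin.card_filter_val_lt, min_eq_right hl, hc]
    have key : ∀ i, c i * (y i - t) ≤ (if i.val < l then 1 else 0) * (y i - t) := by
      intro i
      split_ifs with h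
      · have : t ≤ y i := hy (Fin.le_def.2 (by simp only; omega))
        nlinarith [hc1 i]
      · have : y i ≤ t := hy (Fin.le_def.2 (by simp only; omega))
        nlinarith [hc0 i]
    have := sum_le_sum fun i (_ : i ∈ univ) => key i
    simp only [mul_sub, sum_sub_distrib, ← sum_mul, hc, hcard] at this
    simp only [ite_mul, one_mul, zero_mul, ← sum_filter] at this
    linarith

/-- The permutation listing the entries of a vector in decreasing order. -/
noncomputable def decreasingSort {m : ℕ} (x : Fin m → ℝ) : Equiv.Perm (Fin m) :=
  Fin.revPerm.trans (Tuple.sort x)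

theorem decreasingRearrangement_eq_comp {m : ℕ} (x : Fin m → ℝ) :
    decreasingRearrangement x = x ∘ decreasingSort x := rfl

theorem antitone_decreasingRearrangement {m : ℕ} (x : Fin m → ℝ) :
    Antitone (decreasingRearrangement x) := fun _ _ hij =>
  Tuple.monotone_sort x (Fin.rev_le_rev.2 hij)

theorem decreasingRearrangement_comp_perm {m : ℕ} (x : Fin m → ℝ) (σ : Equiv.Perm (Fin m)) :
    decreasingRearrangement (x ∘ σ) = decreasingRearrangement x :=
  funext fun i => congrFun (Tuple.comp_perm_comp_sort_eq_comp_sort (f := x) (σ := σ)) i.rev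

theorem sum_mul_le_sum_decreasingRearrangement {m : ℕ} {x c : Fin m → ℝ}
    (hc0 : ∀ i, 0 ≤ c i) (hc1 : ∀ i, c i ≤ 1) {l : ℕ} (hl : l ≤ m) (hc : ∑ i, c i = l) :
    ∑ i, c i * x i ≤ ∑ i : Fin m with i.val < l, decreasingRearrangement x i := by
  have := sum_mul_le_sum_filter_lt_of_antitone (c := c ∘ decreasingSort x)
    (antitone_decreasingRearrangement x) (fun _ => hc0 _) (fun _ => hc1 _) hl
    (by rw [← hc]; exact Equiv.sum_comp (decreasingSort x) c)
  refine le_trans (le_of_eq ?_) this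
  exact (Equiv.sum_comp (decreasingSort x) fun i => c i * x i).symm

/-! ### Quadratic forms and the functional calculus -/

/-- The quadratic form `⟪u, B u⟫` of a complex matrix `B`, as a real number: the real part is taken,
which loses nothing when `B` is Hermitian. -/
noncomputable def quadraticForm {m : ℕ} (B : Matrix (Fin m) (Fin m) ℂ)
    (u : EuclideanSpace ℂ (Fin m)) : ℝ :=
  (inner ℂ u (Matrix.toEuclideanLin B u)).re

theorem quadraticForm_weightedSum {m k : ℕ} (w : Fin k → ℝ)
    (B : Fin k → Matrix (Fin m) (Fin m) ℂ) (u : EuclideanSpace ℂ (Fin m)) :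
    quadraticForm (∑ i, w i • B i) u = ∑ i, w i * quadraticForm (B i) u := by
  have h : Matrix.toEuclideanLin (∑ i, w i • B i) u =
      ∑ i, (w i : ℂ) • Matrix.toEuclideanLin (B i) u := by
    rw [map_sum, LinearMap.sum_apply]
    refine Finset.sum_congr rfl fun i _ => ?_
    rw [← LinearMap.smul_apply, ← map_smul, Complex.coe_smul]
  simp only [quadraticForm, h, inner_sum, inner_smul_right, Complex.re_sum, Complex.re_ofReal_mul]

theorem cfc_apply_eigenvectorBasis {m : ℕ} {A : Matrix (Fin m) (Fin m) ℂ} (hA : A.IsHermitian)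
    (φ : ℝ → ℝ) (j : Fin m) :
    Matrix.toEuclideanLin (cfc φ A) (hA.eigenvectorBasis j) =
      (φ (hA.eigenvalues j) : ℂ) • hA.eigenvectorBasis j := by
  apply (WithLp.ofLp_injective 2)
  rw [hA.cfc_eq, Matrix.IsHermitian.cfc, Unitary.conjStarAlgAut_apply, Matrix.toLpLin_apply]
  simp only [← Matrix.mulVec_mulVec, Matrix.IsHermitian.star_eigenvectorUnitary_mulVec,
    Matrix.diagonal_mulVec_single, mul_one, WithLp.ofLp_smul, Function.comp_apply]
  rw [← hA.eigenvectorUnitary_mulVec, ← Matrix.mulVec_smul]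
  simp [← Pi.single_smul]

/-- `⟪u, φ(A) u⟫` is the integral of `φ` against the spectral measure of `A` at `u`. -/
theorem quadraticForm_cfc {m : ℕ} {A : Matrix (Fin m) (Fin m) ℂ} (hA : A.IsHermitian)
    (φ : ℝ → ℝ) (u : EuclideanSpace ℂ (Fin m)) :
    quadraticForm (cfc φ A) u =
      ∑ j, ‖inner ℂ (hA.eigenvectorBasis j) u‖ ^ 2 * φ (hA.eigenvalues j) := by
  have hs : (Matrix.toEuclideanLin (cfc φ A)).IsSymmetric :=
    Matrix.isSymmetric_toEuclideanLin_iff.2 (isHermitian_cfc φ A)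
  rw [quadraticForm, ← hA.eigenvectorBasis.sum_inner_mul_inner, Complex.re_sum]
  refine Finset.sum_congr rfl fun j _ => ?_
  rw [← hs, cfc_apply_eigenvectorBasis, inner_smul_left, Complex.conj_ofReal, mul_left_comm,
    ← inner_conj_symm, Complex.conj_mul', Complex.re_ofReal_mul, ← Complex.ofReal_pow,
    Complex.ofReal_re, mul_comm]

theorem quadraticForm_eq_sum {m : ℕ} {A : Matrix (Fin m) (Fin m) ℂ} (hA : A.IsHermitian)
    (u : EuclideanSpace ℂ (Fin m)) :
    quadraticForm A u =
      ∑ j, ‖inner ℂ (hA.eigenvectorBasis j) u‖ ^ 2 * hA.eigenvalues j := by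
  have h : cfc id A = A := cfc_id ℝ A hA
  exact (congrArg (quadraticForm · u) h).symm.trans (quadraticForm_cfc hA id u)

theorem quadraticForm_eigenvectorBasis {m : ℕ} {A : Matrix (Fin m) (Fin m) ℂ}
    (hA : A.IsHermitian) (j : Fin m) :
    quadraticForm A (hA.eigenvectorBasis j) = hA.eigenvalues j := by
  rw [quadraticForm_eq_sum hA]
  simp [hA.eigenvectorBasis.inner_eq_ite, apply_ite]

theorem sum_norm_inner_eigenvectorBasis_sq {m : ℕ} {A : Matrix (Fin m) (Fin m) ℂ}
    (hA : A.IsHermitian) {u : EuclideanSpace ℂ (Fin m)} (hu : ‖u‖ = 1) :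
    ∑ j, ‖inner ℂ (hA.eigenvectorBasis j) u‖ ^ 2 = 1 := by
  rw [hA.eigenvectorBasis.sum_sq_norm_inner_right, hu, one_pow]

theorem quadraticForm_mem {m : ℕ} {A : Matrix (Fin m) (Fin m) ℂ} (hA : A.IsHermitian)
    {J : Set ℝ} (hJ : Convex ℝ J) (hAJ : spectrum ℝ A ⊆ J)
    {u : EuclideanSpace ℂ (Fin m)} (hu : ‖u‖ = 1) : quadraticForm A u ∈ J := by
  rw [quadraticForm_eq_sum hA]
  exact hJ.sum_mem (fun _ _ => by positivity) (sum_norm_inner_eigenvectorBasis_sq hA hu)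
    fun j _ => hAJ (hA.eigenvalues_mem_spectrum_real j)

/-- Jensen's inequality for the spectral measure of a Hermitian matrix at a unit vector. -/
theorem map_quadraticForm_le {m : ℕ} {A : Matrix (Fin m) (Fin m) ℂ} (hA : A.IsHermitian)
    {J : Set ℝ} {φ : ℝ → ℝ} (hφ : ConvexOn ℝ J φ) (hAJ : spectrum ℝ A ⊆ J)
    {u : EuclideanSpace ℂ (Fin m)} (hu : ‖u‖ = 1) :
    φ (quadraticForm A u) ≤ quadraticForm (cfc φ A) u := by
  rw [quadraticForm_eq_sum hA, quadraticForm_cfc hA]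
  exact hφ.map_sum_le (fun _ _ => by positivity) (sum_norm_inner_eigenvectorBasis_sq hA hu)
    fun j _ => hAJ (hA.eigenvalues_mem_spectrum_real j)

theorem spectrum_weightedSum_subset {m k : ℕ} {J : Set ℝ} (hJ : Convex ℝ J)
    {B : Fin k → Matrix (Fin m) (Fin m) ℂ} (hB : ∀ i, (B i).IsHermitian)
    (hBJ : ∀ i, spectrum ℝ (B i) ⊆ J) {w : Fin k → ℝ} (hw : ∀ i, 0 < w i)
    (hw_sum : ∑ i, w i = 1) : spectrum ℝ (∑ i, w i • B i) ⊆ J := by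
  have hX := isHermitian_weightedSum w hB
  rw [hX.spectrum_real_eq_range_eigenvalues]
  rintro _ ⟨j, rfl⟩
  rw [← quadraticForm_eigenvectorBasis, quadraticForm_weightedSum]
  exact hJ.sum_mem (fun i _ => (hw i).le) hw_sum fun i _ =>
    quadraticForm_mem (hB i) hJ (hBJ i) (hX.eigenvectorBasis.orthonormal.1 j)

theorem map_quadraticForm_weightedSum_le {m k : ℕ} {J : Set ℝ} {φ : ℝ → ℝ}
    (hφ : ConvexOn ℝ J φ) {B : Fin k → Matrix (Fin m) (Fin m) ℂ} (hB : ∀ i, (B i).IsHermitian)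
    (hBJ : ∀ i, spectrum ℝ (B i) ⊆ J) {w : Fin k → ℝ} (hw : ∀ i, 0 < w i)
    (hw_sum : ∑ i, w i = 1) {u : EuclideanSpace ℂ (Fin m)} (hu : ‖u‖ = 1) :
    φ (quadraticForm (∑ i, w i • B i) u) ≤ quadraticForm (∑ i, w i • cfc φ (B i)) u := by
  rw [quadraticForm_weightedSum, quadraticForm_weightedSum]
  refine (hφ.map_sum_le (fun i _ => (hw i).le) hw_sum fun i _ =>
    quadraticForm_mem (hB i) hφ.1 (hBJ i) hu).trans ?_
  exact Finset.sum_le_sum fun i _ =>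
    mul_le_mul_of_nonneg_left (map_quadraticForm_le (hB i) hφ (hBJ i) hu) (hw i).le

/-! ### Weak majorization by eigenvalues -/

/-- The decreasing rearrangement depends only on the multiset of entries. -/
theorem decreasingRearrangement_eq_of_map_eq {m : ℕ} {x y : Fin m → ℝ}
    (h : Finset.univ.val.map x = Finset.univ.val.map y) :
    decreasingRearrangement x = decreasingRearrangement y := by
  have hp : (List.ofFn x).Perm (List.ofFn y) := by
    simpa [Fin.univ_val_map] using h
  have hl : List.ofFn (x ∘ Tuple.sort x) = List.ofFn (y ∘ Tuple.sort y) :=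
    (((Tuple.sort x).ofFn_comp_perm x).trans
      (hp.trans ((Tuple.sort y).ofFn_comp_perm y).symm)).eq_of_pairwise'
      (Tuple.monotone_sort x).sortedLE_ofFn.pairwise
      (Tuple.monotone_sort y).sortedLE_ofFn.pairwise
  funext i
  exact congrFun (List.ofFn_injective hl) i.rev

theorem decreasingRearrangement_eigenvalueVector {m : ℕ} {B : Matrix (Fin m) (Fin m) ℂ}
    (hB : B.IsHermitian) :
    decreasingRearrangement (eigenvalueVector hB) = decreasingRearrangement hB.eigenvalues := by
  let e : Equiv.Perm (Fin m) := (finCongr (Fintype.card_fin m).symm).trans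
    (Fintype.equivOfCardEq (Fintype.card_fin (Fintype.card (Fin m))))
  have : eigenvalueVector hB = hB.eigenvalues ∘ e := by
    funext i
    simp [eigenvalueVector, Matrix.IsHermitian.eigenvalues, e]
  rw [this, decreasingRearrangement_comp_perm]

/-- The eigenvalues of `φ(A)` are the values of `φ` at the eigenvalues of `A`. -/
theorem decreasingRearrangement_eigenvalueVector_cfc {m : ℕ} {A : Matrix (Fin m) (Fin m) ℂ}
    (hA : A.IsHermitian) (φ : ℝ → ℝ) :
    decreasingRearrangement (eigenvalueVector (isHermitian_cfc φ A)) =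
      decreasingRearrangement (φ ∘ hA.eigenvalues) := by
  rw [decreasingRearrangement_eigenvalueVector]
  refine decreasingRearrangement_eq_of_map_eq
    (Multiset.map_injective Complex.ofReal_injective ?_)
  have h := (isHermitian_cfc φ A).roots_charpoly_eq_eigenvalues
  rw [hA.charpoly_cfc_eq φ, Polynomial.roots_prod _ _
    (by simp [Finset.prod_ne_zero_iff, Polynomial.X_sub_C_ne_zero])] at h
  simpa [Multiset.map_map, Multiset.bind_singleton, Function.comp_def] using h.symm

open Finset in
/-- Ky Fan's principle: a vector bounded by the diagonal of `Z` in an orthonormal basis is weakly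
majorized by the eigenvalues of `Z`. -/
theorem weaklyMajorizedBy_eigenvalueVector {m : ℕ} {Z : Matrix (Fin m) (Fin m) ℂ}
    (hZ : Z.IsHermitian) (u : OrthonormalBasis (Fin m) ℂ (EuclideanSpace ℂ (Fin m)))
    {a : Fin m → ℝ} (ha : ∀ j, a j ≤ quadraticForm Z (u j)) :
    a ≺ᵂ eigenvalueVector hZ := by
  intro l hl
  rw [decreasingRearrangement_eigenvalueVector hZ, decreasingRearrangement_eq_comp a]
  set e := decreasingSort a
  -- `c p` is the squared norm of the projection of the `p`-th eigenvector to the span of the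
  -- basis vectors carrying the `l` largest entries of `a`.
  let c : Fin m → ℝ := fun p =>
    ∑ i : Fin m with i.val < l, ‖inner ℂ (hZ.eigenvectorBasis p) (u (e i))‖ ^ 2
  calc ∑ i : Fin m with i.val < l, (a ∘ e) i
      ≤ ∑ i : Fin m with i.val < l, quadraticForm Z (u (e i)) := sum_le_sum fun i _ => ha _
    _ = ∑ p, c p * hZ.eigenvalues p := by
      simp only [quadraticForm_eq_sum hZ, c, sum_mul]
      exact sum_comm
    _ ≤ _ := by
      refine sum_mul_le_sum_decreasingRearrangement (fun p => by positivity) (fun p => ?_) hl ?_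
      · calc c p ≤ ∑ i, ‖inner ℂ (hZ.eigenvectorBasis p) (u (e i))‖ ^ 2 :=
              sum_le_sum_of_subset_of_nonneg (filter_subset _ _) fun _ _ _ => by positivity
          _ = ∑ i, ‖inner ℂ (hZ.eigenvectorBasis p) (u i)‖ ^ 2 :=
              Equiv.sum_comp e fun i => ‖inner ℂ (hZ.eigenvectorBasis p) (u i)‖ ^ 2
          _ = 1 := by
              rw [u.sum_sq_norm_inner_left, hZ.eigenvectorBasis.orthonormal.1, one_pow]
      · simp only [c]
        rw [sum_comm, sum_congr rfl fun i _ => sum_norm_inner_eigenvectorBasis_sq hZ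
          (u.orthonormal.1 (e i))]
        simp [Fin.card_filter_val_lt, hl]

/-- If `φ(t) ≤ ⟪u, Z u⟫` for each vector `u` of an orthonormal eigenbasis of `X`, with eigenvalue
`t`, then `λ(φ(X)) ≺ᵂ λ(Z)`. -/
theorem eigenvalueVector_cfc_weaklyMajorizedBy {m : ℕ} {X Z : Matrix (Fin m) (Fin m) ℂ}
    (hX : X.IsHermitian) (hZ : Z.IsHermitian) {φ : ℝ → ℝ}
    (h : ∀ j, φ (hX.eigenvalues j) ≤ quadraticForm Z (hX.eigenvectorBasis j)) :
    eigenvalueVector (isHermitian_cfc φ X) ≺ᵂ eigenvalueVector hZ := by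
  intro l hl
  rw [decreasingRearrangement_eigenvalueVector_cfc hX]
  exact weaklyMajorizedBy_eigenvalueVector hZ hX.eigenvectorBasis h l hl

/-! ### The inverse of `g` on the range of `g ∘ f` -/

namespace IsGConvex

variable {g f : ℝ → ℝ} {J₁ J₂ : Set ℝ}

theorem inverseOn_apply (h : IsGConvex g f J₁ J₂) {x : ℝ} (hx : x ∈ J₁) :
    inverseOn g J₂ (g (f x)) = f x :=
  h.strictMonoOn.injOn.leftInvOn_invFunOn (h.mapsTo hx)

/-- The restriction of a `g`-convex function to a segment. -/
theorem comp_lineMap (h : IsGConvex g f J₁ J₂) {x y : ℝ} (hx : x ∈ J₁) (hy : y ∈ J₁) :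
    IsGConvex g (f ∘ AffineMap.lineMap (k := ℝ) x y) (Set.Icc 0 1) J₂ := by
  have hm : Set.MapsTo (AffineMap.lineMap (k := ℝ) x y) (Set.Icc 0 1) J₁ := fun t ht =>
    h.convexOn_comp.1.lineMap_mem hx hy ht
  exact
    { mapsTo := h.mapsTo.comp hm
      continuousOn := h.continuousOn.comp AffineMap.lineMap_continuous.continuousOn hm
      strictMonoOn := h.strictMonoOn
      concaveOn := h.concaveOn
      convexOn_comp := (h.convexOn_comp.comp_affineMap (AffineMap.lineMap x y)).subset hm
        (convex_Icc 0 1) }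

/-- The intermediate value property of `g ∘ f` on the unit interval. At the last time `s` with
`g (f s) ≤ c`, the value cannot be below `c` because `g ∘ f`, being convex, is upper semicontinuous
along the segment to `1`, and it cannot be above `c` because `f` is continuous and `g`, being
increasing and concave, is lower semicontinuous at `f s`, which is not the left endpoint of its
domain since `f 0 < f s`. -/
theorem exists_eq_of_unitInterval {c : ℝ} (h : IsGConvex g f (Set.Icc 0 1) J₂)
    (h0 : g (f 0) < c) (h1 : c < g (f 1)) : ∃ t ∈ Set.Icc (0 : ℝ) 1, g (f t) = c := by
  have m0 : (0 : ℝ) ∈ Set.Icc (0 : ℝ) 1 := by simp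
  have m1 : (1 : ℝ) ∈ Set.Icc (0 : ℝ) 1 := by simp
  set T : Set ℝ := {t | t ∈ Set.Icc (0 : ℝ) 1 ∧ g (f t) ≤ c}
  have hT : BddAbove T := ⟨1, fun t ht => ht.1.2⟩
  have hT0 : (0 : ℝ) ∈ T := ⟨m0, h0.le⟩
  set s := sSup T
  have hs : s ∈ Set.Icc (0 : ℝ) 1 := ⟨le_csSup hT hT0, csSup_le ⟨0, hT0⟩ fun t ht => ht.1.2⟩
  refine ⟨s, hs, ?_⟩
  rcases lt_trichotomy (g (f s)) c with hlt | heq | hgt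
  · -- Some `t > s` on the chord from `s` to `1` still satisfies `g (f t) < c`.
    exfalso
    have hs1 : s < 1 := lt_of_le_of_ne hs.2 fun e => (hlt.trans h1).ne (by rw [e])
    obtain ⟨d, hd, hdc⟩ := exists_between hlt
    have hmem : d ∈ openSegment ℝ (g (f s)) (g (f 1)) := by
      rw [openSegment_eq_Ioo (hlt.trans h1)]
      exact ⟨hd, hdc.trans h1⟩
    obtain ⟨a, b, ha, hb, hab, rfl⟩ := hmem
    have ht := h.convexOn_comp.2 hs m1 ha.le hb.le hab
    have hle : a • s + b • (1 : ℝ) ≤ s :=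
      le_csSup hT ⟨h.convexOn_comp.1 hs m1 ha.le hb.le hab, ht.trans hdc.le⟩
    simp only [smul_eq_mul] at hle
    nlinarith
  · exact heq
  · -- Some `r < f s` satisfies `c < g r`, and `f t > r` for `t` near `s`.
    exfalso
    obtain ⟨d, hcd, hd⟩ := exists_between hgt
    have hmem : d ∈ openSegment ℝ (g (f 0)) (g (f s)) := by
      rw [openSegment_eq_Ioo (h0.trans hgt)]
      exact ⟨h0.trans hcd, hd⟩
    obtain ⟨a, b, ha, hb, hab, rfl⟩ := hmem
    have hr := h.concaveOn.2 (h.mapsTo m0) (h.mapsTo hs) ha.le hb.le hab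
    have hrJ := h.concaveOn.1 (h.mapsTo m0) (h.mapsTo hs) ha.le hb.le hab
    have hlt : f 0 < f s :=
      (h.strictMonoOn.lt_iff_lt (h.mapsTo m0) (h.mapsTo hs)).1 (h0.trans hgt)
    have hrs : a • f 0 + b • f s < f s := by
      have : b = 1 - a := by linarith
      simp only [smul_eq_mul, this]
      nlinarith
    obtain ⟨δ, hδ, hδ'⟩ := Metric.continuousOn_iff.1 h.continuousOn s hs _ (sub_pos.2 hrs)
    obtain ⟨t, ht, hst⟩ := exists_lt_of_lt_csSup ⟨0, hT0⟩ (sub_lt_self s hδ)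
    have hts : t ≤ s := le_csSup hT ht
    have hft := hδ' t ht.1 (by rw [Real.dist_eq, abs_lt]; constructor <;> linarith)
    rw [Real.dist_eq, abs_lt] at hft
    have := h.strictMonoOn hrJ (h.mapsTo ht.1) (by linarith [hft.1])
    linarith [ht.2]

/-- The image of `g ∘ f` is an interval. -/
theorem convex_image (h : IsGConvex g f J₁ J₂) : Convex ℝ ((g ∘ f) '' J₁) := by
  refine Set.OrdConnected.convex ⟨?_⟩
  rintro _ ⟨x, hx, rfl⟩ _ ⟨y, hy, rfl⟩ c ⟨hxc, hcy⟩
  rcases hxc.eq_or_lt with rfl | hxc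
  · exact ⟨x, hx, rfl⟩
  rcases hcy.eq_or_lt with rfl | hcy
  · exact ⟨y, hy, rfl⟩
  obtain ⟨t, ht, htc⟩ := (h.comp_lineMap hx hy).exists_eq_of_unitInterval (c := c)
    (by simpa using hxc) (by simpa using hcy)
  exact ⟨_, h.convexOn_comp.1.lineMap_mem hx hy ht, htc⟩

theorem convexOn_inverseOn (h : IsGConvex g f J₁ J₂) :
    ConvexOn ℝ ((g ∘ f) '' J₁) (inverseOn g J₂) := by
  refine ⟨h.convex_image, ?_⟩
  rintro _ ⟨x, hx, rfl⟩ _ ⟨y, hy, rfl⟩ a b ha hb hab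
  obtain ⟨z, hz, hz'⟩ := h.convex_image ⟨x, hx, rfl⟩ ⟨y, hy, rfl⟩ ha hb hab
  have hfx := h.mapsTo hx
  have hfy := h.mapsTo hy
  simp only [Function.comp_apply] at hz' ⊢
  rw [← hz', h.inverseOn_apply hx, h.inverseOn_apply hy, h.inverseOn_apply hz,
    ← h.strictMonoOn.le_iff_le (h.mapsTo hz) (h.concaveOn.1 hfx hfy ha hb hab), hz']
  exact h.concaveOn.2 hfx hfy ha hb hab

theorem monotoneOn_inverseOn (h : IsGConvex g f J₁ J₂) :
    MonotoneOn (inverseOn g J₂) ((g ∘ f) '' J₁) := by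
  rintro _ ⟨x, hx, rfl⟩ _ ⟨y, hy, rfl⟩ hxy
  simp only [Function.comp_apply] at hxy ⊢
  rw [h.inverseOn_apply hx, h.inverseOn_apply hy]
  exact (h.strictMonoOn.le_iff_le (h.mapsTo hx) (h.mapsTo hy)).1 hxy

end IsGConvex

/-! ### Jensen-type majorization -/

theorem spectrum_cfc_subset_image {m : ℕ} {A : Matrix (Fin m) (Fin m) ℂ} (hA : A.IsHermitian)
    {J : Set ℝ} (hAJ : spectrum ℝ A ⊆ J) (φ : ℝ → ℝ) : spectrum ℝ (cfc φ A) ⊆ φ '' J := by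
  -- Every function is continuous on the spectrum, which is finite.
  have h : spectrum ℝ (cfc φ A) = φ '' spectrum ℝ A :=
    cfc_map_spectrum φ A hA (A.finite_real_spectrum.continuousOn φ)
  exact h.trans_subset (Set.image_mono hAJ)

theorem mainTheorem8 {m k : ℕ} (J₁ J₂ : Set ℝ) (f g : ℝ → ℝ) (hfg : IsGConvex g f J₁ J₂)
    (A : Fin k → Matrix (Fin m) (Fin m) ℂ) (hA : ∀ i, (A i).IsHermitian)
    (hJ : ∀ i, spectrum ℝ (A i) ⊆ J₁)
    (w : Fin k → ℝ) (hw : ∀ i, 0 < w i) (hw_sum : ∑ i, w i = 1) :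
    -- the matrices `f (∑ w_i A_i)` and `g⁻¹ (∑ w_i (g ∘ f) (A_i))` are well defined
    spectrum ℝ (∑ i, w i • A i) ⊆ J₁ ∧
    spectrum ℝ (∑ i, w i • cfc (g ∘ f) (A i)) ⊆ g '' J₂ ∧
    -- the two weak majorizations
    eigenvalueVector (isHermitian_cfc f (∑ i, w i • A i)) ≺ᵂ
      eigenvalueVector
        (isHermitian_cfc (inverseOn g J₂) (∑ i, w i • cfc (g ∘ f) (A i))) ∧
    eigenvalueVector
        (isHermitian_cfc (inverseOn g J₂) (∑ i, w i • cfc (g ∘ f) (A i))) ≺ᵂ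
      eigenvalueVector (isHermitian_weightedSum w fun i => isHermitian_cfc f (A i)) := by
  have hB : ∀ i, (cfc (g ∘ f) (A i)).IsHermitian := fun i => isHermitian_cfc _ _
  have hBI : ∀ i, spectrum ℝ (cfc (g ∘ f) (A i)) ⊆ (g ∘ f) '' J₁ := fun i =>
    spectrum_cfc_subset_image (hA i) (hJ i) _
  have hX := isHermitian_weightedSum w hA
  have hY := isHermitian_weightedSum w hB
  have hXJ := spectrum_weightedSum_subset hfg.convexOn_comp.1 hA hJ hw hw_sum
  have hYI := spectrum_weightedSum_subset hfg.convex_image hB hBI hw hw_sum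
  refine ⟨hXJ, hYI.trans ?_, ?_, ?_⟩
  · rw [Set.image_comp]
    exact Set.image_mono hfg.mapsTo.image_subset
  · refine eigenvalueVector_cfc_weaklyMajorizedBy hX _ fun j => ?_
    have hu := hX.eigenvectorBasis.orthonormal.1 j
    have hj := hXJ (hX.eigenvalues_mem_spectrum_real j)
    have hle := map_quadraticForm_weightedSum_le hfg.convexOn_comp hA hJ hw hw_sum hu
    rw [quadraticForm_eigenvectorBasis hX] at hle
    rw [← hfg.inverseOn_apply hj]
    exact (hfg.monotoneOn_inverseOn ⟨_, hj, rfl⟩ (quadraticForm_mem hY hfg.convex_image hYI hu)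
      hle).trans (map_quadraticForm_le hY hfg.convexOn_inverseOn hYI hu)
  · refine eigenvalueVector_cfc_weaklyMajorizedBy hY _ fun j => ?_
    have hu := hY.eigenvectorBasis.orthonormal.1 j
    have hle := map_quadraticForm_weightedSum_le hfg.convexOn_inverseOn hB hBI hw hw_sum hu
    rw [quadraticForm_eigenvectorBasis hY] at hle
    have hk : ∀ i, cfc (inverseOn g J₂) (cfc (g ∘ f) (A i)) = cfc f (A i) := fun i => by
      have hfin := (A i).finite_real_spectrum
      have h : cfc (inverseOn g J₂ ∘ (g ∘ f)) (A i) =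
          cfc (inverseOn g J₂) (cfc (g ∘ f) (A i)) :=
        cfc_comp _ _ (A i) (hA i) ((hfin.image _).continuousOn _) (hfin.continuousOn _)
      exact h.symm.trans (cfc_congr fun t ht => hfg.inverseOn_apply (hJ i ht))
    simpa only [hk] using hle
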